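/- Let $\mathcal H$ be a Hilbert space over $\mathbb K=\mathbb R$ or $\mathbb K=\mathbb C$, and let $k\ge 3$. For $x_1,\dots,x_k\in\mathcal H$ put $$x_1\vee\cdots\vee x_k=\frac1{k!}\sum_{\sigma\in S_k}x_{\sigma(1)}\otimes\cdots\otimes x_{\sigma(k)},$$ the image of $x_1\otimes\cdots\otimes x_k$ under the symmetrization map of the algebraic tensor power $\bigotimes^k\mathcal H$. Let $\bigotimes^{k,s}\mathcal H\subseteq\bigotimes^k\mathcal H$ be the range of the symmetrization map, equipped with the symmetric projective tensor norm $$\pi_s(z)=\inf\Big\{\sum_{j=1}^n|c_j|\,\|y_j\|^k:\ n\ge 0,\ c_j\in\mathbb K,\ y_j\in\mathcal H,\ z=\sum_{j=1}^n c_j\,y_j\otimes\cdots\otimes y_j\Big\}.$$ If $x_1,\dots,x_k\in\mathcal H$ are vectors of norm one, then $\pi_s(x_1\vee\cdots\vee x_k)=1$ if and only if $$\dim\operatorname{span}_{\mathbb K}\{x_1,\dots,x_k\}=1\ \text{ when }\mathbb K=\mathbb C,\qquad \dim\operatorname{span}_{\mathbb K}\{x_1,\dots,x_k\}\in\{1,2\}\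 \text{ when }\mathbb K=\mathbb R.$$ -/

import Mathlib

open scoped TensorProduct Nat

noncomputable section

namespace SymTensor

variable (𝕜 : Type*) [RCLike 𝕜] (H : Type*) [NormedAddCommGroup H] [InnerProductSpace 𝕜 H]

/-- The symmetrization `x₁ ⊗ ⋯ ⊗ xₖ ↦ (1 / k!) ∑_σ x_{σ 1} ⊗ ⋯ ⊗ x_{σ k}` on the algebraic
tensor power `⨂ᵏ H`. -/
def symmetrizer (k : ℕ) :
    (⨂[𝕜] _ : Fin k, H) →ₗ[𝕜] (⨂[𝕜] _ : Fin k, H) :=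
  ((k ! : 𝕜)⁻¹) • ∑ σ : Equiv.Perm (Fin k),
    (PiTensorProduct.reindex 𝕜 (fun _ : Fin k => H) σ).toLinearMap

/-- The `k`-fold symmetric tensor product `⊗^{k,s} H`: the range of the symmetrization. -/
def symPower (k : ℕ) : Submodule 𝕜 (⨂[𝕜] _ : Fin k, H) :=
  LinearMap.range (symmetrizer 𝕜 H k)

variable {H}

/-- The symmetric tensor `x₁ ∨ ⋯ ∨ xₖ`, the symmetrization of `x₁ ⊗ ⋯ ⊗ xₖ`. -/
def symProd {k : ℕ} (x : Fin k → H) : symPower 𝕜 H k :=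
  ⟨symmetrizer 𝕜 H k (PiTensorProduct.tprod 𝕜 x), LinearMap.mem_range_self _ _⟩

theorem coe_symProd {k : ℕ} (x : Fin k → H) :
    (symProd 𝕜 x : ⨂[𝕜] _ : Fin k, H) =
      ((k ! : 𝕜)⁻¹) • ∑ σ : Equiv.Perm (Fin k), PiTensorProduct.tprod 𝕜 (fun i => x (σ i)) := by
  simp only [symProd, symmetrizer, LinearMap.smul_apply, LinearMap.sum_apply,
    LinearEquiv.coe_coe, PiTensorProduct.reindex_tprod]
  congr 1
  exact Equiv.sum_comp (Equiv.inv (Equiv.Perm (Fin k)))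
    (fun σ => PiTensorProduct.tprod 𝕜 (fun i => x (σ i)))

variable {𝕜}

/-- The symmetric projective tensor norm on `⊗^{k,s} H`:
`π_s(z) = inf { ∑ⱼ |cⱼ| ‖yⱼ‖ᵏ : z = ∑ⱼ cⱼ yⱼ ⊗ ⋯ ⊗ yⱼ }`, the infimum being over all finite
representations of `z` (they exist for every symmetric tensor, by polarization). -/
def symProjNorm {k : ℕ} (z : symPower 𝕜 H k) : ℝ :=
  sInf {r : ℝ | ∃ (n : ℕ) (c : Fin n → 𝕜) (y : Fin n → H),
    (z : ⨂[𝕜] _ : Fin k, H) = ∑ j, c j • PiTensorProduct.tprod 𝕜 (fun _ : Fin k => y j) ∧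
    r = ∑ j, ‖c j‖ * ‖y j‖ ^ k}

end SymTensor

end


/-!
If `π_s(x₁ ∨ ⋯ ∨ xₖ) = 1` for unit vectors `xᵢ`, Hahn–Banach gives a symmetric `k`-linear form of
norm at most one on the diagonal, hence everywhere by Banach's theorem, which equals `1` at
`(x₁, …, xₖ)`. Fixing all but three arguments leaves a symmetric trilinear form `T` of norm one
attaining its norm at `(a, b, c)`. A form attaining its norm at `c` is a multiple of `⟪c, ·⟫`, so
`T` also attains its norm at `(u, u, c)` for `u` the normalization of `a + t b`, `|t| = 1`, and from
there at `(w, w, u)` for `w = u + s c`, `|s| = 1`. Comparing the two descriptions of `T w w` relates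
`⟪c, ·⟫` to `⟪u, ·⟫`. Over `ℂ`, varying `s` shows `c ∥ u`; over `ℝ`, taking `t = ±1` shows that `c`
lies in the plane of `a` and `b`.

Conversely, if the span embeds isometrically into a normed field `A` (`A = 𝕜` in dimension one,
`A = ℂ` for a real plane), the product of the `k` images in `A` is a polynomial of norm one
detecting `x₁ ∨ ⋯ ∨ xₖ`.
-/

noncomputable section

namespace SymTensor

open Function
open scoped InnerProductSpace

section Update

variable {ι : Type*} [DecidableEq ι]

theorem norm_update_eq_one {E : Type*} [Norm E] {x : ι → E} {i : ι} {a : E} (hx : ∀ l, ‖x l‖ = 1)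
    (ha : ‖a‖ = 1) (l : ι) : ‖update x i a l‖ = 1 := by
  rw [apply_update fun _ : ι => norm, ha]
  rcases eq_or_ne l i with rfl | h <;> simp [*]

theorem update_update_comp_swap {α : Type*} {i j : ι} (hij : i ≠ j) (x : ι → α) (a b : α) :
    update (update x i a) j b ∘ Equiv.swap i j = update (update x i b) j a := by
  rw [Equiv.comp_swap_eq_update]
  simp only [update_self, update_of_ne hij, update_idem]
  rw [update_comm hij.symm, update_idem, update_comm hij]

variable [Fintype ι]

theorem sum_update {E : Type*} [AddCommGroup E] (x : ι → E) (i : ι) (a : E) :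
    ∑ l, update x i a l = ∑ l, x l - x i + a := by
  rw [Finset.sum_update_of_mem (Finset.mem_univ i), Finset.sdiff_singleton_eq_erase,
    ← Finset.add_sum_erase _ x (Finset.mem_univ i)]
  abel

theorem prod_norm_update {E : Type*} [Norm E] {x : ι → E} {i : ι} (hx : ‖x i‖ = 1) (a : E) :
    ∏ l, ‖update x i a l‖ = ‖a‖ * ∏ l, ‖x l‖ := by
  simp only [apply_update fun _ : ι => norm]
  rw [Finset.prod_update_of_mem (Finset.mem_univ i), Finset.sdiff_singleton_eq_erase,
    ← Finset.mul_prod_erase _ (fun l => ‖x l‖) (Finset.mem_univ i), hx, one_mul]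

end Update

section Norming

variable {𝕜 : Type*} [RCLike 𝕜] {H : Type*} [NormedAddCommGroup H] [InnerProductSpace 𝕜 H]

variable (𝕜) in
theorem exists_unit_smul_eq {v : H} (hv : v ≠ 0) :
    ∃ (r : ℝ) (u : H), 0 < r ∧ ‖u‖ = 1 ∧ v = (r : 𝕜) • u := by
  have hr : (‖v‖ : 𝕜) ≠ 0 := by simpa using hv
  exact ⟨‖v‖, (‖v‖⁻¹ : 𝕜) • v, norm_pos_iff.2 hv, norm_smul_inv_norm hv,
    (smul_inv_smul₀ hr v).symm⟩

theorem norm_sq_add_smul {a b : H} (ha : ‖a‖ = 1) (hb : ‖b‖ = 1) {t : 𝕜} (ht : ‖t‖ = 1) :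
    ((‖a + t • b‖ ^ 2 : ℝ) : 𝕜) = 2 + t * ⟪a, b⟫_𝕜 + starRingEnd 𝕜 t * ⟪b, a⟫_𝕜 := by
  have ht' : starRingEnd 𝕜 t * t = 1 := by simp [RCLike.conj_mul, ht]
  rw [RCLike.ofReal_pow, ← inner_self_eq_norm_sq_to_K, inner_add_left, inner_add_right,
    inner_add_right, inner_smul_left, inner_smul_right, inner_smul_left, inner_smul_right,
    inner_self_eq_norm_sq_to_K, inner_self_eq_norm_sq_to_K, ha, hb]
  push_cast
  linear_combination ht'

theorem map_eq_zero_of_inner_eq_zero {g : H →ₗ[𝕜] 𝕜} {c : H} (hc : ‖c‖ = 1)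
    (hg : ∀ z, ‖g z‖ ≤ ‖g c‖ * ‖z‖) {z : H} (hz : ⟪c, z⟫_𝕜 = 0) : g z = 0 := by
  -- Testing `hg` on this combination of `c` and `z` leaves `‖g z‖ ^ 4 ≤ 0`.
  set p : 𝕜 := (‖z‖ : 𝕜) ^ 2 * starRingEnd 𝕜 (g c) with hp
  set q : 𝕜 := starRingEnd 𝕜 (g z) with hq
  have hval : ‖g (p • c + q • z)‖ = ‖z‖ ^ 2 * ‖g c‖ ^ 2 + ‖g z‖ ^ 2 := by
    have : g (p • c + q • z) = ((‖z‖ ^ 2 * ‖g c‖ ^ 2 + ‖g z‖ ^ 2 : ℝ) : 𝕜) := by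
      simp only [map_add, map_smul, smul_eq_mul, hp, hq, mul_assoc, RCLike.conj_mul]
      push_cast
      ring
    rw [this, RCLike.norm_of_nonneg (by positivity)]
  have hnorm : ‖p • c + q • z‖ ^ 2 = ‖z‖ ^ 2 * (‖z‖ ^ 2 * ‖g c‖ ^ 2 + ‖g z‖ ^ 2) := by
    rw [sq, norm_add_sq_eq_norm_sq_add_norm_sq_of_inner_eq_zero (𝕜 := 𝕜) _ _
      (by rw [inner_smul_left, inner_smul_right, hz, mul_zero, mul_zero])]
    simp only [norm_smul, hc, hp, hq, norm_mul, norm_pow, RCLike.norm_conj, RCLike.norm_ofReal,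
      abs_norm]
    ring
  have hle : ‖g (p • c + q • z)‖ ^ 2 ≤ (‖g c‖ * ‖p • c + q • z‖) ^ 2 := by
    gcongr
    exact hg _
  rw [mul_pow, hval, hnorm] at hle
  have : (‖g z‖ ^ 2) ^ 2 ≤ 0 := by
    nlinarith [mul_nonneg (mul_nonneg (sq_nonneg ‖z‖) (sq_nonneg ‖g c‖)) (sq_nonneg ‖g z‖)]
  simpa using this.antisymm (by positivity)

theorem map_eq_mul_inner {g : H →ₗ[𝕜] 𝕜} {c : H} (hc : ‖c‖ = 1)
    (hg : ∀ z, ‖g z‖ ≤ ‖g c‖ * ‖z‖) (z : H) : g z = g c * ⟪c, z⟫_𝕜 := by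
  have h : g (z - ⟪c, z⟫_𝕜 • c) = 0 := map_eq_zero_of_inner_eq_zero hc hg <| by
    rw [inner_sub_right, inner_smul_right, inner_self_eq_norm_sq_to_K, hc]
    simp
  rw [map_sub, map_smul, sub_eq_zero, smul_eq_mul, mul_comm] at h
  exact h

theorem map_add_smul_self {B : H →ₗ[𝕜] H →ₗ[𝕜] 𝕜} (hB : B.IsSymm) {a b : H} (ha : ‖a‖ = 1)
    (hb : ‖b‖ = 1) (hmax : ∀ v w, ‖B v w‖ ≤ ‖B a b‖ * ‖v‖ * ‖w‖) {t : 𝕜} (ht : ‖t‖ = 1) :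
    B (a + t • b) (a + t • b) = t * ((‖a + t • b‖ ^ 2 : ℝ) : 𝕜) * B a b := by
  have hba : B b a = B a b := hB.eq b a
  have haa : B a a = B a b * ⟪b, a⟫_𝕜 :=
    map_eq_mul_inner hb (fun z => by simpa [ha] using hmax a z) a
  have hbb : B b b = B a b * ⟪a, b⟫_𝕜 := by
    rw [← hba]
    exact map_eq_mul_inner ha (fun z => by simpa [hb, hba] using hmax b z) b
  have ht' : starRingEnd 𝕜 t * t = 1 := by simp [RCLike.conj_mul, ht]
  simp only [map_add, map_smul, LinearMap.add_apply, LinearMap.smul_apply, smul_eq_mul]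
  rw [norm_sq_add_smul ha hb ht, haa, hbb, hba]
  linear_combination (-B a b * ⟪b, a⟫_𝕜) * ht'

theorem map_self_of_add_smul_eq {B : H →ₗ[𝕜] H →ₗ[𝕜] 𝕜} (hB : B.IsSymm) {a b u : H}
    (ha : ‖a‖ = 1) (hb : ‖b‖ = 1) (hmax : ∀ v w, ‖B v w‖ ≤ ‖B a b‖ * ‖v‖ * ‖w‖) {t : 𝕜}
    (ht : ‖t‖ = 1) {r : ℝ} (hr : r ≠ 0) (hu : ‖u‖ = 1) (h : a + t • b = (r : 𝕜) • u) :
    B u u = t * B a b := by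
  have hB' := map_add_smul_self hB ha hb hmax ht
  have hr' : (r : 𝕜) ≠ 0 := RCLike.ofReal_ne_zero.2 hr
  rw [h, norm_smul, hu, RCLike.norm_ofReal, mul_one, sq_abs] at hB'
  simp only [map_smul, LinearMap.smul_apply, smul_eq_mul, RCLike.ofReal_pow] at hB'
  refine mul_left_cancel₀ (pow_ne_zero 2 hr') ?_
  linear_combination hB'

/-- A symmetric trilinear form of norm at most one, written in curried form. -/
structure IsSymmContraction (T : H →ₗ[𝕜] H →ₗ[𝕜] H →ₗ[𝕜] 𝕜) : Prop where
  left_comm : ∀ a b c, T a b c = T b a c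
  right_comm : ∀ a b c, T a b c = T a c b
  norm_le : ∀ a b c, ‖T a b c‖ ≤ ‖a‖ * ‖b‖ * ‖c‖

namespace IsSymmContraction

variable {T : H →ₗ[𝕜] H →ₗ[𝕜] H →ₗ[𝕜] 𝕜}

theorem rotate (hT : IsSymmContraction T) (a b c : H) : T a b c = T c a b := by
  rw [hT.right_comm, hT.left_comm]

theorem isSymm (hT : IsSymmContraction T) (a : H) : (T a).IsSymm :=
  ⟨hT.right_comm a⟩

theorem map_eq_mul_inner (hT : IsSymmContraction T) {a b c : H} (hc : ‖c‖ = 1)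
    (h : ‖T a b c‖ = ‖a‖ * ‖b‖) (z : H) : T a b z = T a b c * ⟪c, z⟫_𝕜 :=
  SymTensor.map_eq_mul_inner hc (fun z => h ▸ hT.norm_le a b z) z

theorem norm_map_le_of_norming (hT : IsSymmContraction T) {a b c : H} (ha : ‖a‖ = 1)
    (h : ‖T a b c‖ = 1) (v w : H) : ‖T a v w‖ ≤ ‖T a b c‖ * ‖v‖ * ‖w‖ := by
  simpa [ha, h] using hT.norm_le a v w

theorem sq_mul_map_sub_eq (hT : IsSymmContraction T) {u c : H} (hu : ‖u‖ = 1) (hc : ‖c‖ = 1)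
    (h : ‖T u u c‖ = 1) {s : 𝕜} (hs : ‖s‖ = 1) (z : H) :
    s ^ 2 * (T c c z - T u u c * ⟪u, c⟫_𝕜 * ⟪u, z⟫_𝕜) =
      T u u c * (⟪c, u⟫_𝕜 * ⟪u, z⟫_𝕜 - ⟪c, z⟫_𝕜) := by
  set w := u + s • c with hw
  have huuz : T u u z = T u u c * ⟪c, z⟫_𝕜 := hT.map_eq_mul_inner hc (by simp [h, hu]) z
  have hucz : T u c z = T u u c * ⟪u, z⟫_𝕜 := by
    rw [hT.right_comm u u c]
    exact hT.map_eq_mul_inner hu (by rw [← hT.right_comm, h, hu, hc, one_mul]) z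
  have hwwu : T w w u = s * ((‖w‖ ^ 2 : ℝ) : 𝕜) * T u u c := by
    rw [hT.rotate]
    exact map_add_smul_self (hT.isSymm u) hu hc (hT.norm_map_le_of_norming hu h) hs
  have hwwz : T w w z = T w w u * ⟪u, z⟫_𝕜 := hT.map_eq_mul_inner hu (by
    rw [hwwu, norm_mul, norm_mul, hs, h, RCLike.norm_of_nonneg (sq_nonneg _)]
    ring) z
  have hexpand : T w w z = T u u z + 2 * s * T u c z + s ^ 2 * T c c z := by
    simp only [hw, map_add, map_smul, LinearMap.add_apply, LinearMap.smul_apply, smul_eq_mul,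
      hT.left_comm c u]
    ring
  have hs' : starRingEnd 𝕜 s * s = 1 := by simp [RCLike.conj_mul, hs]
  rw [hwwz, hwwu, hw, norm_sq_add_smul hu hc hs, huuz, hucz] at hexpand
  linear_combination -hexpand + (T u u c * ⟪c, u⟫_𝕜 * ⟪u, z⟫_𝕜) * hs'

theorem map_self_of_add_smul_eq (hT : IsSymmContraction T) {a b c u : H} (ha : ‖a‖ = 1)
    (hb : ‖b‖ = 1) (hc : ‖c‖ = 1) (h : ‖T a b c‖ = 1) {t : 𝕜} (ht : ‖t‖ = 1) {r : ℝ} (hr : r ≠ 0)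
    (hu : ‖u‖ = 1) (hru : a + t • b = (r : 𝕜) • u) : T u u c = t * T a b c := by
  rw [hT.rotate a b c] at h ⊢
  rw [hT.rotate u u c]
  exact SymTensor.map_self_of_add_smul_eq (hT.isSymm c) ha hb (hT.norm_map_le_of_norming hc h) ht
    hr hu hru

theorem mem_span_pair (hT : IsSymmContraction T) {a b c : H} (ha : ‖a‖ = 1) (hb : ‖b‖ = 1)
    (hc : ‖c‖ = 1) (h : ‖T a b c‖ = 1) (hab : b ∉ Submodule.span 𝕜 {a}) :
    c ∈ Submodule.span 𝕜 {a, b} := by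
  have hε : T a b c ≠ 0 := norm_ne_zero_iff.1 (by simp [h])
  have exists_unit {t : 𝕜} (ht : ‖t‖ = 1) :
      ∃ u ∈ Submodule.span 𝕜 {a, b}, ‖u‖ = 1 ∧ T u u c = t * T a b c := by
    have ht0 : t ≠ 0 := norm_ne_zero_iff.1 (by simp [ht])
    have hne : a + t • b ≠ 0 := fun h0 => hab <| (Submodule.smul_mem_iff _ ht0).1 <| by
      rw [eq_neg_of_add_eq_zero_right h0]
      exact neg_mem (Submodule.mem_span_singleton_self a)
    obtain ⟨r, u, hr, hu, hru⟩ := exists_unit_smul_eq 𝕜 hne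
    refine ⟨u, ?_, hu, hT.map_self_of_add_smul_eq ha hb hc h ht hr.ne' hu hru⟩
    rw [← Submodule.smul_mem_iff _ (RCLike.ofReal_ne_zero (K := 𝕜).2 hr.ne'), ← hru]
    exact Submodule.mem_span_pair.2 ⟨1, t, by rw [one_smul]⟩
  obtain ⟨u, hu, hu1, hTu⟩ := exists_unit (t := 1) (by simp)
  obtain ⟨v, hv, hv1, hTv⟩ := exists_unit (t := -1) (by simp)
  -- `T u u c` and `T v v c` are opposite, so adding the two identities eliminates `T c c z`.
  have hcomb : (2 : 𝕜) • c = (⟪c, u⟫_𝕜 + ⟪u, c⟫_𝕜) • u + (⟪c, v⟫_𝕜 + ⟪v, c⟫_𝕜) • v := by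
    refine ext_inner_right 𝕜 fun z => mul_left_cancel₀ hε ?_
    have eu := hT.sq_mul_map_sub_eq hu1 hc (by simp [hTu, h]) (s := 1) (by simp) z
    have ev := hT.sq_mul_map_sub_eq hv1 hc (by simp [hTv, h]) (s := 1) (by simp) z
    rw [hTu] at eu
    rw [hTv] at ev
    simp only [inner_add_left, inner_smul_left, map_add, inner_conj_symm, map_ofNat]
    linear_combination eu - ev
  rw [← Submodule.smul_mem_iff _ (two_ne_zero (α := 𝕜)), hcomb]
  exact add_mem (Submodule.smul_mem _ _ hu) (Submodule.smul_mem _ _ hv)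

end IsSymmContraction
end Norming

section ComplexNorming

variable {H : Type*} [NormedAddCommGroup H] [InnerProductSpace ℂ H] {T : H →ₗ[ℂ] H →ₗ[ℂ] H →ₗ[ℂ] ℂ}

namespace IsSymmContraction

theorem eq_inner_smul (hT : IsSymmContraction T) {u c : H} (hu : ‖u‖ = 1) (hc : ‖c‖ = 1)
    (h : ‖T u u c‖ = 1) : c = ⟪u, c⟫_ℂ • u := by
  have hε : T u u c ≠ 0 := norm_ne_zero_iff.1 (by simp [h])
  refine ext_inner_right ℂ fun z => mul_left_cancel₀ (mul_ne_zero two_ne_zero hε) ?_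
  have h_one := hT.sq_mul_map_sub_eq hu hc h (s := 1) (by simp) z
  have h_I := hT.sq_mul_map_sub_eq hu hc h (s := Complex.I) (by simp) z
  rw [Complex.I_sq] at h_I
  rw [inner_smul_left, inner_conj_symm]
  linear_combination h_one + h_I

theorem mem_span_singleton (hT : IsSymmContraction T) {a b c : H} (ha : ‖a‖ = 1) (hb : ‖b‖ = 1)
    (hc : ‖c‖ = 1) (h : ‖T a b c‖ = 1) : a ∈ Submodule.span ℂ {c} := by
  have add_mem_span {t : ℂ} (ht : ‖t‖ = 1) : a + t • b ∈ Submodule.span ℂ {c} := by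
    by_cases hne : a + t • b = 0
    · exact hne ▸ zero_mem _
    obtain ⟨r, u, hr, hu, hru⟩ := exists_unit_smul_eq ℂ hne
    have hTu : ‖T u u c‖ = 1 := by
      rw [hT.map_self_of_add_smul_eq ha hb hc h ht hr.ne' hu hru, norm_mul, ht, h, one_mul]
    have hcu : c = ⟪u, c⟫_ℂ • u := hT.eq_inner_smul hu hc hTu
    have hne' : ⟪u, c⟫_ℂ ≠ 0 := fun h0 => by
      rw [h0, zero_smul] at hcu
      simp [hcu] at hc
    rw [hru]
    refine Submodule.smul_mem _ _ ((Submodule.smul_mem_iff _ hne').1 ?_)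
    exact hcu ▸ Submodule.mem_span_singleton_self c
  have h_two : (2 : ℂ) • a = (a + (1 : ℂ) • b) + (a + (-1 : ℂ) • b) := by module
  rw [← Submodule.smul_mem_iff _ (two_ne_zero (α := ℂ)), h_two]
  exact add_mem (add_mem_span (by simp)) (add_mem_span (by simp))

end IsSymmContraction
end ComplexNorming

section Slices

variable {𝕜 ι : Type*} [DecidableEq ι]

section Module

variable [CommSemiring 𝕜] {E F : Type*} [AddCommMonoid E] [Module 𝕜 E] [AddCommMonoid F]
  [Module 𝕜 F] {f : MultilinearMap 𝕜 (fun _ : ι => E) F}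

/-- A multilinear map is symmetric if its value does not depend on the order of the arguments. -/
def IsSymmetric (f : MultilinearMap 𝕜 (fun _ : ι => E) F) : Prop :=
  ∀ (σ : Equiv.Perm ι) (x : ι → E), f (x ∘ σ) = f x

/-- The bilinear map obtained from `f` by fixing all arguments at `x` except those at `i` and
`j`. -/
def biSlice (f : MultilinearMap 𝕜 (fun _ : ι => E) F) (x : ι → E) {i j : ι} (hij : i ≠ j) :
    E →ₗ[𝕜] E →ₗ[𝕜] F where
  toFun a := f.toLinearMap (update x i a) j
  map_add' a b := by
    ext c
    simp [update_comm hij]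
  map_smul' r a := by
    ext c
    simp [update_comm hij]

@[simp]
theorem biSlice_apply (x : ι → E) {i j : ι} (hij : i ≠ j) (a b : E) :
    biSlice f x hij a b = f (update (update x i a) j b) :=
  rfl

theorem IsSymmetric.biSlice_comm (hf : IsSymmetric f) (x : ι → E) {i j : ι} (hij : i ≠ j)
    (a b : E) : biSlice f x hij a b = biSlice f x hij b a := by
  rw [biSlice_apply, biSlice_apply, ← update_update_comp_swap hij, hf]

/-- The trilinear map obtained from `f` by fixing all arguments at `x` except those at `i`, `j` and
`l`. -/
def triSlice (f : MultilinearMap 𝕜 (fun _ : ι => E) F) (x : ι → E) {i j l : ι} (hij : i ≠ j)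
    (hil : i ≠ l) (hjl : j ≠ l) : E →ₗ[𝕜] E →ₗ[𝕜] E →ₗ[𝕜] F where
  toFun a := biSlice f (update x i a) hjl
  map_add' a b := by
    ext c d
    simp [update_comm hij, update_comm hil]
  map_smul' r a := by
    ext c d
    simp [update_comm hij, update_comm hil]

@[simp]
theorem triSlice_apply (x : ι → E) {i j l : ι} (hij : i ≠ j) (hil : i ≠ l) (hjl : j ≠ l)
    (a b c : E) :
    triSlice f x hij hil hjl a b c = f (update (update (update x i a) j b) l c) :=
  rfl

end Module

section InnerProduct

variable [RCLike 𝕜] [Fintype ι] {E : Type*} [NormedAddCommGroup E] [InnerProductSpace 𝕜 E]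
  {f : MultilinearMap 𝕜 (fun _ : ι => E) 𝕜} {x : ι → E}

theorem isSymmContraction_triSlice (hf : IsSymmetric f) (hle : ∀ y, ‖f y‖ ≤ ∏ m, ‖y m‖)
    (hx : ∀ m, ‖x m‖ = 1) {i j l : ι} (hij : i ≠ j) (hil : i ≠ l) (hjl : j ≠ l) :
    IsSymmContraction (triSlice f x hij hil hjl) where
  left_comm a b c := by
    rw [triSlice_apply, triSlice_apply, update_comm hjl, update_comm hil, update_comm hjl,
      update_comm hil]
    exact hf.biSlice_comm (update x l c) hij a b
  right_comm a b c := hf.biSlice_comm (update x i a) hjl b c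
  norm_le a b c := by
    refine (hle _).trans_eq ?_
    rw [prod_norm_update, prod_norm_update, prod_norm_update (hx i)]
    · simp only [hx, Finset.prod_const_one]
      ring
    · simp [hij.symm, hx]
    · simp [hil.symm, hjl.symm, hx]

end InnerProduct
end Slices

section Continuity

variable {𝕜 ι : Type*} [NontriviallyNormedField 𝕜] [CompleteSpace 𝕜] [Finite ι] {E : ι → Type*}
  [∀ i, AddCommGroup (E i)] [∀ i, Module 𝕜 (E i)] [∀ i, TopologicalSpace (E i)]
  [∀ i, IsTopologicalAddGroup (E i)] [∀ i, ContinuousSMul 𝕜 (E i)] [∀ i, T2Space (E i)]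
  [∀ i, FiniteDimensional 𝕜 (E i)] {F : Type*} [AddCommGroup F] [Module 𝕜 F] [TopologicalSpace F]
  [ContinuousAdd F] [ContinuousSMul 𝕜 F]

theorem multilinearMap_continuous_of_finiteDimensional (f : MultilinearMap 𝕜 E F) :
    Continuous f := by
  classical
  have := Fintype.ofFinite ι
  let b i := Module.finBasis 𝕜 (E i)
  have expand (x : ∀ i, E i) :
      f x = ∑ r : ∀ i, Fin (Module.finrank 𝕜 (E i)),
        (∏ i, (b i).coord (r i) (x i)) • f fun i => b i (r i) := by
    conv_lhs => rw [show x = fun i => ∑ j, (b i).coord j (x i) • b i j from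
      funext fun i => ((b i).sum_repr (x i)).symm, f.map_sum]
    simp only [f.map_smul_univ]
  rw [show ⇑f = _ from funext expand]
  refine continuous_finsetSum _ fun r _ => Continuous.smul ?_ continuous_const
  exact continuous_finsetProd _ fun i _ =>
    ((b i).coord (r i)).continuous_of_finiteDimensional.comp (continuous_apply i)

end Continuity

section Homogeneity

variable {𝕜 ι : Type*} [RCLike 𝕜] [Fintype ι] {E : ι → Type*} [∀ i, NormedAddCommGroup (E i)]
  [∀ i, NormedSpace 𝕜 (E i)] {F : Type*} [NormedAddCommGroup F] [NormedSpace 𝕜 F]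

theorem norm_map_le_mul_prod_norm {f : MultilinearMap 𝕜 E F} {M : ℝ}
    (hf : ∀ x, (∀ i, ‖x i‖ = 1) → ‖f x‖ ≤ M) (x : ∀ i, E i) : ‖f x‖ ≤ M * ∏ i, ‖x i‖ := by
  by_cases hx : ∃ i, x i = 0
  · obtain ⟨i, hi⟩ := hx
    rw [f.map_coord_zero i hi, norm_zero,
      Finset.prod_eq_zero (Finset.mem_univ i) (by rw [hi, norm_zero]), mul_zero]
  push Not at hx
  have hsmul : x = fun i => (‖x i‖ : 𝕜) • ((‖x i‖ : 𝕜)⁻¹ • x i) :=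
    funext fun i => (smul_inv_smul₀ (by simpa using hx i) _).symm
  conv_lhs => rw [hsmul, f.map_smul_univ, norm_smul, norm_prod]
  simp only [RCLike.norm_ofReal, abs_norm]
  rw [mul_comm]
  gcongr
  exact hf _ fun i => norm_smul_inv_norm (hx i)

end Homogeneity

section Banach

variable {𝕜 : Type*} [RCLike 𝕜] {ι : Type*} [Fintype ι] {E : Type*} [NormedAddCommGroup E]
  [InnerProductSpace 𝕜 E] {f : MultilinearMap 𝕜 (fun _ : ι => E) 𝕜} {x : ι → E}

/-- A tuple of unit vectors at which `‖f‖` is maximal among tuples of unit vectors and which, among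
all such maximizers, has a sum of maximal norm. For symmetric `f` all its entries are equal, which
is how Banach's theorem is proved here. -/
structure IsExtremalTuple (f : MultilinearMap 𝕜 (fun _ : ι => E) 𝕜) (x : ι → E) : Prop where
  norm_eq_one : ∀ i, ‖x i‖ = 1
  norm_map_le : ∀ y : ι → E, (∀ i, ‖y i‖ = 1) → ‖f y‖ ≤ ‖f x‖
  norm_sum_le : ∀ y : ι → E, (∀ i, ‖y i‖ = 1) → ‖f y‖ = ‖f x‖ → ‖∑ i, y i‖ ≤ ‖∑ i, x i‖

theorem exists_isExtremalTuple [FiniteDimensional 𝕜 E] (f : MultilinearMap 𝕜 (fun _ : ι => E) 𝕜)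
    (hx : ∀ i, ‖x i‖ = 1) : ∃ y, IsExtremalTuple f y := by
  have : ProperSpace E := FiniteDimensional.proper_rclike 𝕜 E
  have hf : Continuous f := multilinearMap_continuous_of_finiteDimensional f
  let K : Set (ι → E) := Set.univ.pi fun _ => Metric.sphere 0 1
  have mem_K (y : ι → E) : y ∈ K ↔ ∀ i, ‖y i‖ = 1 := by simp [K]
  have hK : IsCompact K := isCompact_univ_pi fun _ => isCompact_sphere _ _
  obtain ⟨z, hzK, hz⟩ := hK.exists_isMaxOn ⟨x, (mem_K x).2 hx⟩ hf.norm.continuousOn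
  have hK' : IsCompact (K ∩ {y | ‖f y‖ = ‖f z‖}) :=
    hK.inter_right (isClosed_eq hf.norm continuous_const)
  obtain ⟨y, ⟨hyK, hyz : ‖f y‖ = ‖f z‖⟩, hy⟩ :=
    hK'.exists_isMaxOn (f := fun y => ‖∑ i, y i‖) ⟨z, hzK, rfl⟩ (by fun_prop)
  exact ⟨y, (mem_K y).1 hyK, fun w hw => hyz ▸ hz ((mem_K w).2 hw),
    fun w hw hwy => hy ⟨(mem_K w).2 hw, hwy.trans hyz⟩⟩

theorem two_mul_re_inner_le {S d : E} (h : ‖S + d‖ ≤ ‖S‖) :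
    2 * RCLike.re ⟪S, d⟫_𝕜 ≤ -‖d‖ ^ 2 := by
  have h' : ‖S + d‖ ^ 2 ≤ ‖S‖ ^ 2 := by gcongr
  rw [norm_add_sq (𝕜 := 𝕜)] at h'
  linarith

namespace IsExtremalTuple

theorem one_le_re_inner_sum (h : IsExtremalTuple f x) (i : ι) :
    1 ≤ RCLike.re ⟪∑ l, x l, x i⟫_𝕜 := by
  classical
  have hflip : ‖∑ l, x l + -(x i + x i)‖ ≤ ‖∑ l, x l‖ := by
    convert h.norm_sum_le (update x i (-x i))
      (norm_update_eq_one h.norm_eq_one (by rw [norm_neg, h.norm_eq_one])) (by simp) using 2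
    rw [sum_update]
    abel
  have := two_mul_re_inner_le (𝕜 := 𝕜) hflip
  rw [inner_neg_right, inner_add_right, map_neg, map_add, norm_neg, ← two_smul 𝕜 (x i),
    norm_smul, h.norm_eq_one, RCLike.norm_two] at this
  norm_num at this
  linarith

theorem norm_map_update_update [DecidableEq ι] (h : IsExtremalTuple f x) (hf : IsSymmetric f)
    {i j : ι} (hij : i ≠ j) {u : E} (hu : ‖u‖ = 1) {r : ℝ} (hr : 0 < r)
    (hru : x i + x j = (r : 𝕜) • u) : ‖f (update (update x i u) j u)‖ = ‖f x‖ := by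
  have hmax (v w : E) :
      ‖biSlice f x hij v w‖ ≤ ‖biSlice f x hij (x i) (x j)‖ * ‖v‖ * ‖w‖ := by
    have hle := norm_map_le_mul_prod_norm h.norm_map_le (update (update x i v) j w)
    rw [prod_norm_update (by simp [hij.symm, h.norm_eq_one]), prod_norm_update (h.norm_eq_one i)]
      at hle
    simp only [h.norm_eq_one, Finset.prod_const_one] at hle
    simpa [mul_comm, mul_assoc, mul_left_comm] using hle
  have := map_self_of_add_smul_eq ⟨hf.biSlice_comm x hij⟩ (h.norm_eq_one i) (h.norm_eq_one j) hmax
    (t := 1) (by simp) hr.ne' hu (by rwa [one_smul])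
  simp only [biSlice_apply, update_eq_self, one_mul] at this
  rw [this]

theorem apply_eq (h : IsExtremalTuple f x) (hf : IsSymmetric f) (i j : ι) : x i = x j := by
  classical
  rcases eq_or_ne i j with rfl | hij
  · rfl
  set S := ∑ l, x l
  have hS : 2 ≤ RCLike.re ⟪S, x i + x j⟫_𝕜 := by
    rw [inner_add_right, map_add]
    linarith [h.one_le_re_inner_sum i, h.one_le_re_inner_sum j]
  have hne : x i + x j ≠ 0 := fun h0 => by
    rw [h0, inner_zero_right, map_zero] at hS
    linarith
  obtain ⟨r, u, hr, hu, hru⟩ := exists_unit_smul_eq 𝕜 hne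
  have hSu : ‖S + (u + u - (x i + x j))‖ ≤ ‖S‖ := by
    convert h.norm_sum_le (update (update x i u) j u)
      (norm_update_eq_one (norm_update_eq_one h.norm_eq_one hu) hu)
      (h.norm_map_update_update hf hij hu hr hru) using 2
    rw [sum_update, sum_update, update_of_ne hij.symm]
    abel
  have hr2 : 2 ≤ r := by
    have := two_mul_re_inner_le (𝕜 := 𝕜) hSu
    rw [hru, inner_smul_right, RCLike.re_ofReal_mul] at hS
    rw [hru, inner_sub_right, inner_add_right, inner_smul_right, map_sub, map_add,
      RCLike.re_ofReal_mul] at this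
    nlinarith [sq_nonneg ‖u + u - (r : 𝕜) • u‖]
  have hnorm : ‖x i + x j‖ = r := by
    rw [hru, norm_smul, hu, RCLike.norm_of_nonneg hr.le, mul_one]
  have hpar := parallelogram_law_with_norm 𝕜 (x i) (x j)
  rw [h.norm_eq_one, h.norm_eq_one, hnorm] at hpar
  refine sub_eq_zero.1 (norm_eq_zero.1 (pow_eq_zero_iff two_ne_zero |>.1 ?_))
  nlinarith [sq_nonneg ‖x i - x j‖]

end IsExtremalTuple

theorem norm_map_le_of_finiteDimensional [FiniteDimensional 𝕜 E] (hf : IsSymmetric f) {M : ℝ}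
    (hdiag : ∀ y, ‖f fun _ => y‖ ≤ M * ‖y‖ ^ Fintype.card ι) (x : ι → E) :
    ‖f x‖ ≤ M * ∏ i, ‖x i‖ := by
  refine norm_map_le_mul_prod_norm (fun x hx => ?_) x
  obtain ⟨y, hy⟩ := exists_isExtremalTuple f hx
  obtain ⟨v, hv, hyv⟩ : ∃ v, ‖v‖ ^ Fintype.card ι = 1 ∧ y = fun _ => v := by
    rcases isEmpty_or_nonempty ι with _ | ⟨⟨i⟩⟩
    · exact ⟨0, by simp, Subsingleton.elim _ _⟩
    · exact ⟨y i, by simp [hy.norm_eq_one], funext fun j => hy.apply_eq hf j i⟩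
  calc ‖f x‖ ≤ ‖f y‖ := hy.norm_map_le x hx
    _ ≤ M := by simpa [hyv, hv] using hdiag v

/-- **Banach's theorem**. -/
theorem norm_map_le_of_norm_map_const_le (hf : IsSymmetric f) {M : ℝ}
    (hdiag : ∀ y, ‖f fun _ => y‖ ≤ M * ‖y‖ ^ Fintype.card ι) (x : ι → E) :
    ‖f x‖ ≤ M * ∏ i, ‖x i‖ := by
  let V := Submodule.span 𝕜 (Set.range x)
  have : FiniteDimensional 𝕜 V := FiniteDimensional.span_of_finite 𝕜 (Set.finite_range x)
  exact norm_map_le_of_finiteDimensional (f := f.compLinearMap fun _ => V.subtype)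
    (fun σ y => hf σ fun i => y i) (fun y => hdiag y)
    fun i => ⟨x i, Submodule.subset_span (Set.mem_range_self i)⟩

end Banach

section ProjectiveNorm

variable {𝕜 : Type*} [RCLike 𝕜] {H : Type*} [NormedAddCommGroup H] [InnerProductSpace 𝕜 H] {k : ℕ}

theorem symProd_comp_perm (σ : Equiv.Perm (Fin k)) (x : Fin k → H) :
    symProd 𝕜 (x ∘ σ) = symProd 𝕜 x := by
  apply Subtype.ext
  rw [coe_symProd, coe_symProd]
  congr 1
  exact Equiv.sum_comp (Equiv.mulLeft σ)
    (fun τ => PiTensorProduct.tprod 𝕜 (fun i => x (τ i)))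

theorem lift_symProd {F : Type*} [AddCommGroup F] [Module 𝕜 F]
    {f : MultilinearMap 𝕜 (fun _ : Fin k => H) F} (hf : IsSymmetric f) (x : Fin k → H) :
    PiTensorProduct.lift f (symProd 𝕜 x) = f x := by
  have hperm (σ : Equiv.Perm (Fin k)) : f (fun i => x (σ i)) = f x := hf σ x
  simp only [coe_symProd, map_smul, map_sum, PiTensorProduct.lift.tprod, hperm, Finset.sum_const,
    Finset.card_univ, Fintype.card_perm, Fintype.card_fin]
  rw [← Nat.cast_smul_eq_nsmul 𝕜, inv_smul_smul₀ (Nat.cast_ne_zero.2 k.factorial_ne_zero)]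

theorem coe_symProd_const (y : H) :
    (symProd 𝕜 (fun _ : Fin k => y) : ⨂[𝕜] _ : Fin k, H) =
      PiTensorProduct.tprod 𝕜 (fun _ : Fin k => y) := by
  rw [coe_symProd, Finset.sum_const, Finset.card_univ, Fintype.card_perm, Fintype.card_fin,
    ← Nat.cast_smul_eq_nsmul 𝕜, inv_smul_smul₀ (Nat.cast_ne_zero.2 k.factorial_ne_zero)]

/-- The multilinear map `x ↦ ξ (x₁ ∨ ⋯ ∨ xₖ)` associated with a linear form on the symmetric
power. -/
def symForm (ξ : symPower 𝕜 H k →ₗ[𝕜] 𝕜) : MultilinearMap 𝕜 (fun _ : Fin k => H) 𝕜 :=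
  (ξ ∘ₗ (symmetrizer 𝕜 H k).rangeRestrict).compMultilinearMap (PiTensorProduct.tprod 𝕜)

theorem symForm_apply (ξ : symPower 𝕜 H k →ₗ[𝕜] 𝕜) (x : Fin k → H) :
    symForm ξ x = ξ (symProd 𝕜 x) :=
  rfl

theorem isSymmetric_symForm (ξ : symPower 𝕜 H k →ₗ[𝕜] 𝕜) : IsSymmetric (symForm ξ) := fun σ x => by
  rw [symForm_apply, symForm_apply, symProd_comp_perm]

theorem norm_map_symProd_le {ξ : symPower 𝕜 H k →ₗ[𝕜] 𝕜} {M : ℝ}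
    (hξ : ∀ y, ‖ξ (symProd 𝕜 fun _ => y)‖ ≤ M * ‖y‖ ^ k) (x : Fin k → H) :
    ‖ξ (symProd 𝕜 x)‖ ≤ M * ∏ i, ‖x i‖ :=
  norm_map_le_of_norm_map_const_le (isSymmetric_symForm ξ)
    (fun y => by simpa [symForm_apply] using hξ y) x

theorem span_range_symProd :
    Submodule.span 𝕜 (Set.range fun x : Fin k → H => symProd 𝕜 x) = ⊤ := by
  have h := congrArg (Submodule.map (symmetrizer 𝕜 H k).rangeRestrict)
    (PiTensorProduct.span_tprod_eq_top (R := 𝕜) (s := fun _ : Fin k => H))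
  rwa [Submodule.map_span, Submodule.map_top, LinearMap.range_rangeRestrict, ← Set.range_comp] at h

-- A form vanishing on all powers vanishes everywhere, by Banach's theorem with bound `0`.
theorem span_range_symProd_const :
    Submodule.span 𝕜 (Set.range fun y : H => symProd 𝕜 (fun _ : Fin k => y)) = ⊤ := by
  rw [eq_top_iff, ← span_range_symProd, Submodule.span_le]
  rintro _ ⟨x, rfl⟩
  by_contra hx
  obtain ⟨ξ, hξx, hξ⟩ := Submodule.exists_le_ker_of_notMem hx
  have hle := norm_map_symProd_le (𝕜 := 𝕜) (M := 0) (fun y => by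
    rw [LinearMap.mem_ker.1 (hξ (Submodule.subset_span ⟨y, rfl⟩)), norm_zero, zero_mul]) x
  rw [zero_mul] at hle
  exact hξx (norm_le_zero_iff.1 hle)

/-- The costs `∑ⱼ |cⱼ| ‖yⱼ‖ᵏ` of the representations `z = ∑ⱼ cⱼ yⱼ ⊗ ⋯ ⊗ yⱼ`, so that `π_s(z)` is
the infimum of this set. -/
def symReprCosts (z : symPower 𝕜 H k) : Set ℝ :=
  {r : ℝ | ∃ (n : ℕ) (c : Fin n → 𝕜) (y : Fin n → H),
    (z : ⨂[𝕜] _ : Fin k, H) = ∑ j, c j • PiTensorProduct.tprod 𝕜 (fun _ : Fin k => y j) ∧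
    r = ∑ j, ‖c j‖ * ‖y j‖ ^ k}

theorem symProjNorm_eq_sInf (z : symPower 𝕜 H k) : symProjNorm z = sInf (symReprCosts z) :=
  rfl

theorem nonneg_of_mem_symReprCosts {z : symPower 𝕜 H k} {r : ℝ} (hr : r ∈ symReprCosts z) :
    0 ≤ r := by
  obtain ⟨n, c, y, -, rfl⟩ := hr
  positivity

theorem symReprCosts_nonempty (z : symPower 𝕜 H k) : (symReprCosts z).Nonempty := by
  have hz : z ∈ Submodule.span 𝕜 (Set.range fun y : H => symProd 𝕜 (fun _ : Fin k => y)) := by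
    rw [span_range_symProd_const]
    exact Submodule.mem_top
  obtain ⟨n, c, g, rfl⟩ := Submodule.mem_span_set'.1 hz
  choose y hy using fun j => (g j).2
  refine ⟨_, n, c, y, ?_, rfl⟩
  simp only [Submodule.coe_sum, Submodule.coe_smul, ← hy, coe_symProd_const]

theorem add_mem_symReprCosts_add {z w : symPower 𝕜 H k} {r s : ℝ} (hr : r ∈ symReprCosts z)
    (hs : s ∈ symReprCosts w) : r + s ∈ symReprCosts (z + w) := by
  obtain ⟨n, c, y, hz, rfl⟩ := hr
  obtain ⟨m, d, v, hw, rfl⟩ := hs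
  refine ⟨n + m, Fin.append c d, Fin.append y v, ?_, ?_⟩
  · simp [Fin.sum_univ_add, hz, hw]
  · simp [Fin.sum_univ_add]

theorem norm_mul_mem_symReprCosts_smul {z : symPower 𝕜 H k} {r : ℝ} (a : 𝕜)
    (hr : r ∈ symReprCosts z) : ‖a‖ * r ∈ symReprCosts (a • z) := by
  obtain ⟨n, c, y, hz, rfl⟩ := hr
  refine ⟨n, fun j => a * c j, y, ?_, ?_⟩
  · simp [hz, Finset.smul_sum, smul_smul]
  · simp [Finset.mul_sum, mul_assoc]

theorem symProjNorm_le {z : symPower 𝕜 H k} {r : ℝ} (hr : r ∈ symReprCosts z) :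
    symProjNorm z ≤ r :=
  csInf_le ⟨0, fun _ => nonneg_of_mem_symReprCosts⟩ hr

theorem symProjNorm_nonneg (z : symPower 𝕜 H k) : 0 ≤ symProjNorm z :=
  Real.sInf_nonneg fun _ => nonneg_of_mem_symReprCosts

theorem symProjNorm_zero : symProjNorm (0 : symPower 𝕜 H k) = 0 :=
  (symProjNorm_le ⟨0, Fin.elim0, Fin.elim0, by simp, by simp⟩).antisymm (symProjNorm_nonneg 0)

theorem symProjNorm_add_le (z w : symPower 𝕜 H k) :
    symProjNorm (z + w) ≤ symProjNorm z + symProjNorm w := by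
  refine le_of_forall_pos_lt_add fun ε hε => ?_
  obtain ⟨r, hr, hrz⟩ := Real.lt_sInf_add_pos (symReprCosts_nonempty z) (half_pos hε)
  obtain ⟨s, hs, hsw⟩ := Real.lt_sInf_add_pos (symReprCosts_nonempty w) (half_pos hε)
  rw [← symProjNorm_eq_sInf] at hrz hsw
  linarith [symProjNorm_le (add_mem_symReprCosts_add hr hs)]

theorem symProjNorm_smul_le (a : 𝕜) (z : symPower 𝕜 H k) :
    symProjNorm (a • z) ≤ ‖a‖ * symProjNorm z := by
  rw [symProjNorm_eq_sInf z, ← smul_eq_mul, ← Real.sInf_smul_of_nonneg (norm_nonneg a)]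
  refine le_csInf (symReprCosts_nonempty z).smul_set ?_
  rintro _ ⟨r, hr, rfl⟩
  exact symProjNorm_le (norm_mul_mem_symReprCosts_smul a hr)

theorem symProjNorm_symProd_const_le (y : H) :
    symProjNorm (symProd 𝕜 (fun _ : Fin k => y)) ≤ ‖y‖ ^ k :=
  symProjNorm_le ⟨1, fun _ => 1, fun _ => y, by simp [coe_symProd_const], by simp⟩

/-- The symmetric projective tensor norm as a bundled seminorm, the form in which Hahn–Banach
applies to it. -/
def symProjSeminorm : Seminorm 𝕜 (symPower 𝕜 H k) :=
  Seminorm.ofSMulLE symProjNorm symProjNorm_zero symProjNorm_add_le symProjNorm_smul_le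

theorem exists_dual_eq_seminorm {V : Type*} [AddCommGroup V] [Module 𝕜 V] (p : Seminorm 𝕜 V)
    (z : V) : ∃ ξ : V →ₗ[𝕜] 𝕜, ξ z = (p z : 𝕜) ∧ ∀ w, ‖ξ w‖ ≤ p w := by
  rcases eq_or_ne z 0 with rfl | hz
  · exact ⟨0, by simp, fun w => by simp⟩
  have hcoord (w : Submodule.span 𝕜 {z}) :
      ‖((p z : 𝕜) • (LinearEquiv.coord 𝕜 V z hz).toLinearMap) w‖ ≤ p w := by
    rw [← LinearEquiv.coord_apply_smul 𝕜 V z hz w, map_smul_eq_mul]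
    rw [LinearMap.smul_apply, LinearEquiv.coe_coe, norm_smul, RCLike.norm_ofReal,
      abs_of_nonneg (apply_nonneg p z), mul_comm]
  obtain ⟨ξ, hξ, hle⟩ := Module.Dual.exists_extension_of_le_seminorm _ _ hcoord
  refine ⟨ξ, ?_, hle⟩
  have := hξ ⟨z, Submodule.mem_span_singleton_self z⟩
  rwa [LinearMap.smul_apply, LinearEquiv.coe_coe, LinearEquiv.coord_self, smul_eq_mul,
    mul_one] at this

theorem exists_norming_form (x : Fin k → H) :
    ∃ f : MultilinearMap 𝕜 (fun _ : Fin k => H) 𝕜, IsSymmetric f ∧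
      f x = (symProjNorm (symProd 𝕜 x) : 𝕜) ∧ ∀ y, ‖f y‖ ≤ ∏ i, ‖y i‖ := by
  obtain ⟨ξ, hξx, hξ⟩ := exists_dual_eq_seminorm symProjSeminorm (symProd 𝕜 x)
  refine ⟨symForm ξ, isSymmetric_symForm ξ, hξx, fun y => ?_⟩
  have hconst (v : H) : ‖ξ (symProd 𝕜 fun _ => v)‖ ≤ 1 * ‖v‖ ^ k := by
    rw [one_mul]
    exact (hξ _).trans (symProjNorm_symProd_const_le v)
  simpa only [one_mul, symForm_apply] using norm_map_symProd_le hconst y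

theorem symProjNorm_symProd_le (x : Fin k → H) : symProjNorm (symProd 𝕜 x) ≤ ∏ i, ‖x i‖ := by
  obtain ⟨f, -, hfx, hf⟩ := exists_norming_form (𝕜 := 𝕜) x
  simpa [hfx, abs_of_nonneg (symProjNorm_nonneg _)] using hf x

theorem norm_map_le_symProjNorm {A : Type*} [SeminormedAddCommGroup A] [NormedSpace 𝕜 A]
    {L : (⨂[𝕜] _ : Fin k, H) →ₗ[𝕜] A}
    (hL : ∀ y : H, ‖L (PiTensorProduct.tprod 𝕜 fun _ => y)‖ ≤ ‖y‖ ^ k) (z : symPower 𝕜 H k) :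
    ‖L z‖ ≤ symProjNorm z := by
  refine le_csInf (symReprCosts_nonempty z) ?_
  rintro _ ⟨n, c, y, hz, rfl⟩
  rw [hz, map_sum]
  refine norm_sum_le_of_le _ fun j _ => ?_
  rw [map_smul, norm_smul]
  gcongr
  exact hL _

theorem prod_norm_map_le_symProjNorm {A : Type*} [NormedField A] [NormedAlgebra 𝕜 A]
    {g : H →ₗ[𝕜] A} (hg : ∀ y, ‖g y‖ ≤ ‖y‖) (x : Fin k → H) :
    ∏ i, ‖g (x i)‖ ≤ symProjNorm (symProd 𝕜 x) := by
  let f := (MultilinearMap.mkPiAlgebra 𝕜 (Fin k) A).compLinearMap fun _ => g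
  have hf_apply (y : Fin k → H) : f y = ∏ i, g (y i) := by simp [f]
  have hf : IsSymmetric f := fun σ y => by
    simpa only [hf_apply] using! Equiv.prod_comp σ fun i => g (y i)
  rw [← norm_prod, ← hf_apply, ← lift_symProd hf]
  refine norm_map_le_symProjNorm (fun y => ?_) _
  rw [PiTensorProduct.lift.tprod, hf_apply, Finset.prod_const, Finset.card_univ, Fintype.card_fin,
    norm_pow]
  gcongr
  exact hg y

theorem symProjNorm_symProd_eq_prod_norm {A : Type*} [NormedField A] [NormedAlgebra 𝕜 A]
    {x : Fin k → H} (e : Submodule.span 𝕜 (Set.range x) →ₗᵢ[𝕜] A) :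
    symProjNorm (symProd 𝕜 x) = ∏ i, ‖x i‖ := by
  refine (symProjNorm_symProd_le x).antisymm ?_
  have : FiniteDimensional 𝕜 (Submodule.span 𝕜 (Set.range x)) :=
    FiniteDimensional.span_of_finite 𝕜 (Set.finite_range x)
  let P := (Submodule.span 𝕜 (Set.range x)).orthogonalProjectionOnto
  have hP (y : H) : ‖e (P y)‖ ≤ ‖y‖ :=
    (e.norm_map _).trans_le (Submodule.norm_orthogonalProjectionOnto_apply_le _ y)
  have hPx (i : Fin k) : ‖e (P (x i))‖ = ‖x i‖ := by
    rw [e.norm_map]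
    exact congrArg norm (Submodule.orthogonalProjectionOnto_mem_subspace_eq_self
      ⟨x i, Submodule.subset_span (Set.mem_range_self i)⟩)
  simpa only [LinearMap.comp_apply, LinearIsometry.coe_toLinearMap, ContinuousLinearMap.coe_coe,
    hPx] using prod_norm_map_le_symProjNorm (g := e.toLinearMap ∘ₗ P.toLinearMap) hP x

end ProjectiveNorm

section Dimension

theorem nonempty_linearIsometryEquiv {𝕜 V W : Type*} [RCLike 𝕜] [NormedAddCommGroup V]
    [InnerProductSpace 𝕜 V] [FiniteDimensional 𝕜 V] [NormedAddCommGroup W] [InnerProductSpace 𝕜 W]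
    [FiniteDimensional 𝕜 W] (h : Module.finrank 𝕜 V = Module.finrank 𝕜 W) :
    Nonempty (V ≃ₗᵢ[𝕜] W) :=
  ⟨(stdOrthonormalBasis 𝕜 V).equiv (stdOrthonormalBasis 𝕜 W) (finCongr h)⟩

theorem finrank_span_range_le_one {K V ι : Type*} [Field K] [AddCommGroup V] [Module K V]
    {x : ι → V} (hx : ∀ i j, x j ∈ Submodule.span K {x i}) :
    Module.finrank K (Submodule.span K (Set.range x)) ≤ 1 := by
  rcases isEmpty_or_nonempty ι with _ | ⟨⟨i⟩⟩
  · rw [Set.range_eq_empty, Submodule.span_empty, finrank_bot]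
    exact zero_le_one
  calc Module.finrank K (Submodule.span K (Set.range x))
      ≤ Module.finrank K (Submodule.span K {x i}) :=
        Submodule.finrank_mono (Submodule.span_le.2 (Set.range_subset_iff.2 (hx i)))
    _ ≤ 1 := by simpa using finrank_span_le_card (R := K) {x i}

variable {𝕜 : Type*} [RCLike 𝕜] {H : Type*} [NormedAddCommGroup H] [InnerProductSpace 𝕜 H] {k : ℕ}
  {x : Fin k → H}

theorem finrank_span_range_pos (hk : k ≠ 0) (hx : ∀ i, ‖x i‖ = 1) :
    0 < Module.finrank 𝕜 (Submodule.span 𝕜 (Set.range x)) := by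
  have : FiniteDimensional 𝕜 (Submodule.span 𝕜 (Set.range x)) :=
    FiniteDimensional.span_of_finite 𝕜 (Set.finite_range x)
  rw [Nat.pos_iff_ne_zero, Ne, Submodule.finrank_eq_zero, Submodule.span_eq_bot]
  intro h
  have h0 := h (x ⟨0, Nat.pos_of_ne_zero hk⟩) (Set.mem_range_self _)
  simpa [h0] using hx ⟨0, Nat.pos_of_ne_zero hk⟩

theorem exists_isSymmContraction (hx : ∀ i, ‖x i‖ = 1) (h : symProjNorm (symProd 𝕜 x) = 1)
    {i j l : Fin k} (hij : i ≠ j) (hil : i ≠ l) (hjl : j ≠ l) :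
    ∃ T : H →ₗ[𝕜] H →ₗ[𝕜] H →ₗ[𝕜] 𝕜, IsSymmContraction T ∧ ‖T (x i) (x j) (x l)‖ = 1 := by
  obtain ⟨f, hf, hfx, hle⟩ := exists_norming_form (𝕜 := 𝕜) x
  refine ⟨triSlice f x hij hil hjl, isSymmContraction_triSlice hf hle hx hij hil hjl, ?_⟩
  simp [hfx, h]

theorem finrank_span_range_le_two (hx : ∀ i, ‖x i‖ = 1) (h : symProjNorm (symProd 𝕜 x) = 1) :
    Module.finrank 𝕜 (Submodule.span 𝕜 (Set.range x)) ≤ 2 := by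
  classical
  by_cases hline : ∀ i j, x j ∈ Submodule.span 𝕜 {x i}
  · exact (finrank_span_range_le_one hline).trans one_le_two
  push Not at hline
  obtain ⟨i, j, hij⟩ := hline
  have hne : i ≠ j := by
    rintro rfl
    exact hij (Submodule.mem_span_singleton_self _)
  have hmem (l : Fin k) : x l ∈ Submodule.span 𝕜 {x i, x j} := by
    rcases eq_or_ne i l with rfl | hil
    · exact Submodule.subset_span (by simp)
    rcases eq_or_ne j l with rfl | hjl
    · exact Submodule.subset_span (by simp)
    obtain ⟨T, hT, hTx⟩ := exists_isSymmContraction hx h hne hil hjl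
    exact hT.mem_span_pair (hx i) (hx j) (hx l) hTx hij
  have : FiniteDimensional 𝕜 (Submodule.span 𝕜 {x i, x j}) :=
    FiniteDimensional.span_of_finite 𝕜 (Set.toFinite _)
  calc Module.finrank 𝕜 (Submodule.span 𝕜 (Set.range x))
      ≤ Module.finrank 𝕜 (Submodule.span 𝕜 {x i, x j}) :=
        Submodule.finrank_mono (Submodule.span_le.2 (Set.range_subset_iff.2 hmem))
    _ ≤ ({x i, x j} : Finset H).card := by
        rw [← Finset.coe_pair]
        exact finrank_span_finset_le_card _
    _ ≤ 2 := Finset.card_le_two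

theorem symProjNorm_symProd_eq_one {A : Type*} [NormedField A] [NormedAlgebra 𝕜 A]
    (hx : ∀ i, ‖x i‖ = 1) (h : Nonempty (Submodule.span 𝕜 (Set.range x) ≃ₗᵢ[𝕜] A)) :
    symProjNorm (symProd 𝕜 x) = 1 := by
  obtain ⟨e⟩ := h
  simp [symProjNorm_symProd_eq_prod_norm e.toLinearIsometry, hx]

end Dimension

theorem finrank_span_range_le_one_of_complex {H : Type*} [NormedAddCommGroup H]
    [InnerProductSpace ℂ H] {k : ℕ} (hk : 3 ≤ k) {x : Fin k → H} (hx : ∀ i, ‖x i‖ = 1)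
    (h : symProjNorm (symProd ℂ x) = 1) :
    Module.finrank ℂ (Submodule.span ℂ (Set.range x)) ≤ 1 := by
  refine finrank_span_range_le_one fun i j => ?_
  rcases eq_or_ne j i with rfl | hji
  · exact Submodule.mem_span_singleton_self _
  obtain ⟨l, hli, hlj⟩ := Fin.exists_ne_and_ne_of_two_lt i j hk
  obtain ⟨T, hT, hTx⟩ := exists_isSymmContraction hx h hlj.symm hji hli
  exact hT.mem_span_singleton (hx j) (hx l) (hx i) hTx

end SymTensor

end

theorem proposition1p1_general (k : ℕ) (hk : 3 ≤ k) :
    (∀ (H : Type*) [NormedAddCommGroup H] [InnerProductSpace ℂ H]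
        (x : Fin k → H), (∀ i, ‖x i‖ = 1) →
        (SymTensor.symProjNorm (SymTensor.symProd ℂ x) = 1 ↔
          Module.finrank ℂ (Submodule.span ℂ (Set.range x)) = 1)) ∧
    (∀ (H : Type*) [NormedAddCommGroup H] [InnerProductSpace ℝ H]
        (x : Fin k → H), (∀ i, ‖x i‖ = 1) →
        (SymTensor.symProjNorm (SymTensor.symProd ℝ x) = 1 ↔
          (Module.finrank ℝ (Submodule.span ℝ (Set.range x)) = 1 ∨
            Module.finrank ℝ (Submodule.span ℝ (Set.range x)) = 2))) := by
  refine ⟨fun H _ _ x hx => ?_, fun H _ _ x hx => ?_⟩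
  · have hpos := SymTensor.finrank_span_range_pos (𝕜 := ℂ) (by lia) hx
    have := FiniteDimensional.span_of_finite ℂ (Set.finite_range x)
    refine ⟨fun h => ?_, fun h => ?_⟩
    · exact (SymTensor.finrank_span_range_le_one_of_complex hk hx h).antisymm hpos
    · exact SymTensor.symProjNorm_symProd_eq_one hx
        (SymTensor.nonempty_linearIsometryEquiv (h.trans (Module.finrank_self ℂ).symm))
  · have hpos := SymTensor.finrank_span_range_pos (𝕜 := ℝ) (by lia) hx
    have := FiniteDimensional.span_of_finite ℝ (Set.finite_range x)
    refine ⟨fun h => ?_, ?_⟩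
    · have hle := SymTensor.finrank_span_range_le_two hx h
      lia
    · rintro (h | h)
      · exact SymTensor.symProjNorm_symProd_eq_one hx
          (SymTensor.nonempty_linearIsometryEquiv (h.trans (Module.finrank_self ℝ).symm))
      · exact SymTensor.symProjNorm_symProd_eq_one hx
          (SymTensor.nonempty_linearIsometryEquiv (h.trans Complex.finrank_real_complex.symm))

theorem proposition1p1 (k : ℕ) (hk : 3 ≤ k) :
    (∀ (H : Type*) [NormedAddCommGroup H] [InnerProductSpace ℂ H] [CompleteSpace H]
        (x : Fin k → H), (∀ i, ‖x i‖ = 1) →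
        (SymTensor.symProjNorm (SymTensor.symProd ℂ x) = 1 ↔
          Module.finrank ℂ (Submodule.span ℂ (Set.range x)) = 1)) ∧
    (∀ (H : Type*) [NormedAddCommGroup H] [InnerProductSpace ℝ H] [CompleteSpace H]
        (x : Fin k → H), (∀ i, ‖x i‖ = 1) →
        (SymTensor.symProjNorm (SymTensor.symProd ℝ x) = 1 ↔
          (Module.finrank ℝ (Submodule.span ℝ (Set.range x)) = 1 ∨
            Module.finrank ℝ (Submodule.span ℝ (Set.range x)) = 2))) :=
  (proposition1p1_general k hk).imp (fun h H _ _ _ => h H) (fun h H _ _ _ => h H)
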